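/- **Setting.** Let $\mathscr{P}_2(\mathbb{R}^n)$ be the set of Borel probability measures on $\mathbb{R}^n$ with finite second moment, equipped with the 2-Wasserstein distance $$W_2(\rho,\rho')=\Big(\inf_{\pi}\int \|x-y\|^2\,d\pi(x,y)\Big)^{1/2},$$ the infimum being over all couplings $\pi$ of $\rho$ and $\rho'$; compactness in $\mathscr{P}_2(\mathbb{R}^n)$ is with respect to $W_2$. Let $\sigma\in\mathscr{P}_2(\mathbb{R}^n)$ be absolutely continuous with respect to Lebesgue measure. For $\rho\in\mathscr{P}_2(\mathbb{R}^n)$ let $F_\sigma(\rho)=T_\sigma^\rho\in L^2(\mathbb{R}^n,\sigma)$ be the optimal transport map from $\sigma$ to $\rho$, i.e. the ($\sigma$-a.e. unique) minimizer of $\int\|T(x)-x\|^2\,d\sigma(x)$ among all maps $T$ with $T_\sharp\sigma=\rho$. Write $\|f\|_\sigma$ for the norm of $L^2(\mathbb{R}^n,\sigma)$. **Theorem.** Let $\sigma,\mu,\nu\in\mathscr{P}_2(\mathbb{R}^n)$ with $\sigma$ absolutely continuous with respect to Lebesgue measure, let $\varepsilon>0$, and let $\mathcal{H}$ be a convex set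 of maps $h:\mathbb{R}^n\to\mathbb{R}^n$, each of which belongs to $L^2(\mathbb{R}^n,\sigma)$, $L^2(\mathbb{R}^n,\mu)$ and $L^2(\mathbb{R}^n,\nu)$. Suppose that $F_\sigma$ is $\varepsilon$-compatible with both $\mu$- and $\nu$-orbits with respect to the action of $\mathcal{H}$, i.e. for all $h\in\mathcal{H}$ $$\|F_\sigma(h_\sharp\mu)-h\circ F_\sigma(\mu)\|_\sigma<\varepsilon\quad\text{and}\quad \|F_\sigma(h_\sharp\nu)-h\circ F_\sigma(\nu)\|_\sigma<\varepsilon .$$ Suppose further that the orbits $\mathcal{H}\star\mu=\{h_\sharp\mu: h\in\mathcal{H}\}$ and $\mathcal{H}\star\nu=\{h_\sharp\nu: h\in\mathcal{H}\}$ are compact, and that $W_2({h_1}_\sharp\mu,{h_2}_\sharp\nu)>6\varepsilon$ for all $h_1,h_2\in\mathcal{H}$. Then $F_\sigma(\mathcal{H}\star\mu)$ and $F_\sigma(\mathcal{H}\star\nu)$ are linearly separable in $L^2(\mathbb{R}^n,\sigma)$: there are $w\in L^2(\mathbb{R}^n,\sigma)$ and $b\in\mathbb{R}$ with $\langle w,f\rangle_\sigma<b$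 for all $f\in F_\sigma(\mathcal{H}\star\mu)$ and $\langle w,g\rangle_\sigma>b$ for all $g\in F_\sigma(\mathcal{H}\star\nu)$. -/

import Mathlib

open MeasureTheory
open scoped ENNReal

noncomputable section

namespace LOT

/-- Euclidean space `ℝⁿ`. -/
abbrev E (n : ℕ) : Type := EuclideanSpace ℝ (Fin n)

/-- `𝒫₂(ℝⁿ)`: Borel probability measures on `ℝⁿ` with finite second moment. -/
structure P2 (n : ℕ) where
  toMeasure : Measure (E n)
  isProbabilityMeasure : IsProbabilityMeasure toMeasure
  secondMoment_lt_top : ∫⁻ x, ‖x‖ₑ ^ 2 ∂toMeasure < ∞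

/-- The `2`-Wasserstein distance: the square root of the infimum of the quadratic transport cost
over all couplings of `μ` and `ν`. -/
def W2 {n : ℕ} (μ ν : Measure (E n)) : ℝ≥0∞ :=
  (⨅ (π : Measure (E n × E n)) (_ : π.map Prod.fst = μ ∧ π.map Prod.snd = ν),
    ∫⁻ p, ‖p.1 - p.2‖ₑ ^ 2 ∂π) ^ (1 / 2 : ℝ)

/-- `𝒫₂(ℝⁿ)` carries the topology whose subbasis consists of the open `W₂`-balls; since `W₂` is a
metric on `𝒫₂(ℝⁿ)`, this is its metric topology. -/
instance (n : ℕ) : TopologicalSpace (P2 n) :=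
  TopologicalSpace.generateFrom
    {U | ∃ (μ : P2 n) (r : ℝ≥0∞), U = {ν : P2 n | W2 μ.toMeasure ν.toMeasure < r}}

/-- `T` is an optimal transport map from `σ` to `ν` for the quadratic cost: it pushes `σ` forward
to `ν` and has minimal cost among all maps that do so. -/
def IsOptimalTransportMap {n : ℕ} (σ ν : Measure (E n)) (T : E n → E n) : Prop :=
  AEMeasurable T σ ∧ σ.map T = ν ∧
    ∀ S : E n → E n, AEMeasurable S σ → σ.map S = ν →
      ∫⁻ x, ‖T x - x‖ₑ ^ 2 ∂σ ≤ ∫⁻ x, ‖S x - x‖ₑ ^ 2 ∂σ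

open Classical in
/-- The linear optimal transport embedding `F_σ(ν) = T_σ^ν ∈ L²(ℝⁿ, σ)`, the optimal transport map
from `σ` to `ν` (and `0` if there is none, which never happens if `σ, ν ∈ 𝒫₂(ℝⁿ)` and `σ` is
absolutely continuous). -/
def lot {n : ℕ} (σ ν : Measure (E n)) : Lp (E n) 2 σ :=
  if h : ∃ T : Lp (E n) 2 σ, IsOptimalTransportMap σ ν T then h.choose else 0

/-- The orbit `ℋ ⋆ μ = {h_♯ μ : h ∈ ℋ}`, as a subset of `𝒫₂(ℝⁿ)`. It is used for `ℋ` with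
`h ∈ L²(ℝⁿ, μ)` for all `h ∈ ℋ`, in which case every `h_♯ μ` lies in `𝒫₂(ℝⁿ)`. -/
def orbit {n : ℕ} (H : Set (E n → E n)) (μ : P2 n) : Set (P2 n) :=
  {ρ | ∃ h ∈ H, ρ.toMeasure = μ.toMeasure.map h}

/-- `F_σ` is `ε`-compatible with `μ`-orbits with respect to the action of `ℋ`:
`‖F_σ(h_♯ μ) - h ∘ F_σ(μ)‖_σ < ε` for all `h ∈ ℋ`. -/
def IsEpsCompatible {n : ℕ} (σ μ : P2 n) (H : Set (E n → E n)) (ε : ℝ) : Prop :=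
  ∀ h ∈ H,
    eLpNorm (fun x => lot σ.toMeasure (μ.toMeasure.map h) x - h (lot σ.toMeasure μ.toMeasure x))
      2 σ.toMeasure < ENNReal.ofReal ε

/-- The image `F_σ(A)` of a set `A ⊆ 𝒫₂(ℝⁿ)` in `L²(ℝⁿ, σ)`. -/
def lotImage {n : ℕ} (σ : P2 n) (A : Set (P2 n)) : Set (Lp (E n) 2 σ.toMeasure) :=
  (fun ρ : P2 n => lot σ.toMeasure ρ.toMeasure) '' A

/-- Two subsets of a real inner product space are linearly separable: some hyperplane
`⟨w, ·⟩ = b` has them strictly on different sides. -/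
def LinearlySeparable {V : Type*} [NormedAddCommGroup V] [InnerProductSpace ℝ V]
    (A B : Set V) : Prop :=
  ∃ (w : V) (b : ℝ), (∀ f ∈ A, inner ℝ w f < b) ∧ (∀ g ∈ B, b < inner ℝ w g)

end LOT

end

namespace LOT

open Filter Topology ProbabilityTheory
open scoped NNReal

/-! For fixed `T = F_σ(μ)`, the maps `h ∘ T` with `h ∈ ℋ` form a convex subset of `L²(σ)`, and
compatibility puts `F_σ(ℋ ⋆ μ)` in its open `ε`-thickening; likewise for `ν`. If the two thickenings
met, two embedded orbit points would be less than `4ε` apart. But `W₂(ρ, ρ') ≤ ‖F_σ(ρ) -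
F_σ(ρ')‖_σ`, because `(F_σ(ρ), F_σ(ρ'))_♯ σ` is a coupling, so this contradicts the `6ε` gap.
Hahn–Banach then separates the two disjoint open convex sets
(`linearlySeparable_of_convex_thickening`).

Most of the work is to show that `F_σ(ρ)` really is a transport map
(`exists_isOptimalTransportMap`). An optimal plan exists by Prokhorov and lower semicontinuity; its
support is monotone, hence single-valued off a Lebesgue-null set, so the plan is the graph of a map.
-/

/-! ### Lower semicontinuity under weak convergence -/

/-- The integral is the supremum of the integrals of the bounded truncations `min f N`, each weakly
continuous in the measure. -/
theorem lowerSemicontinuous_lintegral_continuous {X : Type*} [TopologicalSpace X]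
    [MeasurableSpace X] [OpensMeasurableSpace X] {f : X → ℝ≥0} (hf : Continuous f) :
    LowerSemicontinuous fun μ : ProbabilityMeasure X => ∫⁻ x, f x ∂(μ : Measure X) := by
  have key : (fun μ : ProbabilityMeasure X => ∫⁻ x, f x ∂(μ : Measure X)) =
      fun μ : ProbabilityMeasure X => ⨆ N : ℕ, ∫⁻ x, (min (f x) N : ℝ≥0) ∂(μ : Measure X) := by
    funext μ
    rw [← lintegral_iSup]
    · refine lintegral_congr fun x => le_antisymm ?_ ?_
      · obtain ⟨N, hN⟩ := exists_nat_ge (f x)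
        refine le_iSup_of_le N ?_
        rw [min_eq_left hN]
      · exact iSup_le fun N => by exact_mod_cast min_le_left _ _
    · intro N
      exact (measurable_coe_nnreal_ennreal.comp (hf.min continuous_const).measurable)
    · intro N M h x
      have : (N : ℝ≥0) ≤ M := by exact_mod_cast h
      simp only
      gcongr
  rw [key]
  refine lowerSemicontinuous_iSup fun N => Continuous.lowerSemicontinuous ?_
  let g : BoundedContinuousFunction X ℝ≥0 :=
    BoundedContinuousFunction.mkOfBound ⟨fun x => min (f x) N, hf.min continuous_const⟩ N
      (fun x y => by
        rw [NNReal.dist_eq, abs_sub_le_iff]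
        have h1 : ((min (f x) N : ℝ≥0) : ℝ) ≤ N := by exact_mod_cast min_le_right _ _
        have h2 : ((min (f y) N : ℝ≥0) : ℝ) ≤ N := by exact_mod_cast min_le_right _ _
        have h3 := (min (f x) N : ℝ≥0).coe_nonneg
        have h4 := (min (f y) N : ℝ≥0).coe_nonneg
        constructor
        · change ((min (f x) N : ℝ≥0) : ℝ) - (min (f y) N : ℝ≥0) ≤ N
          linarith
        · change ((min (f y) N : ℝ≥0) : ℝ) - (min (f x) N : ℝ≥0) ≤ N
          linarith)
  exact ProbabilityMeasure.continuous_lintegral_boundedContinuousFunction g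

/-! ### Monotone relations are almost everywhere single-valued -/

/-- The set of points over which a closed monotone relation is multivalued is Lebesgue null. -/
theorem volume_multivalued_of_monotone {n : ℕ} {Γ : Set (E n × E n)} (hΓ : IsClosed Γ)
    (hmono : ∀ p ∈ Γ, ∀ q ∈ Γ, 0 ≤ inner ℝ (p.1 - q.1) (p.2 - q.2)) :
    volume {x : E n | ∃ y z, (x, y) ∈ Γ ∧ (x, z) ∈ Γ ∧ y ≠ z} = 0 := by
  let S : Fin n → ℚ → ℚ → Set (E n) := fun i a b =>
    Prod.fst '' (Γ ∩ {p | p.2 i ≤ a}) ∩ Prod.fst '' (Γ ∩ {p | (b : ℝ) ≤ p.2 i})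
  -- Closed subsets of `ℝⁿ × ℝⁿ` are σ-compact, so their projections are Borel.
  have meas_image : ∀ C : Set (E n × E n), IsClosed C → MeasurableSet (Prod.fst '' C) := by
    intro C hC
    obtain ⟨K, hK, hKC⟩ := 
      (isSigmaCompact_univ.of_isClosed_subset hC (Set.subset_univ C)).image continuous_fst
    rw [← hKC]
    exact MeasurableSet.iUnion fun k => (hK k).measurableSet
  -- If two points of `S i a b` differ by `t • eᵢ` with `t ≠ 0`, monotonicity orders all `i`-th
  -- coordinates of their values, but each point has a value `≤ a` and one `≥ b`. So infinitely many
  -- bounded translates along `eᵢ` are disjoint, which forces measure zero.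
  have hS : ∀ i a b, a < b → volume (S i a b) = 0 := by
    intro i a b hab
    have hab' : (a : ℝ) < b := by exact_mod_cast hab
    refine Measure.addHaar_eq_zero_of_disjoint_translates volume
      (fun k : ℕ => (1 / ((k : ℝ) + 1)) • EuclideanSpace.single i (1 : ℝ)) ?_ ?_ ?_
    · refine (Metric.isBounded_closedBall (x := (0 : E n)) (r := 1)).subset ?_
      rintro _ ⟨k, rfl⟩
      have : 0 < (k : ℝ) + 1 := by positivity
      simp only [mem_closedBall_zero_iff, norm_smul, PiLp.norm_single, norm_one, mul_one,
        Real.norm_eq_abs]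
      rw [abs_of_pos (by positivity), div_le_one this]
      linarith [(Nat.cast_nonneg k : (0 : ℝ) ≤ k)]
    · intro k l hkl
      rw [Function.onFun, Set.disjoint_left]
      rintro _ hk hl
      simp only [Set.singleton_add, Set.mem_image] at hk hl
      obtain ⟨x, hx, rfl⟩ := hk
      obtain ⟨x', hx', hxx⟩ := hl
      set t : ℝ := 1 / ((l : ℝ) + 1) - 1 / ((k : ℝ) + 1) with ht
      have ht0 : t ≠ 0 := by
        intro h0
        have : (l : ℝ) + 1 = k + 1 := by
          have := sub_eq_zero.1 (ht ▸ h0)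
          simpa using this
        exact hkl (by exact_mod_cast (add_right_cancel this).symm)
      have hd : x - x' = t • EuclideanSpace.single i (1 : ℝ) := by
        rw [ht, sub_smul, sub_eq_sub_iff_add_eq_add, add_comm x, ← hxx]
      have hinner : ∀ y y' : E n, (x, y) ∈ Γ → (x', y') ∈ Γ → 0 ≤ t * (y i - y' i) := by
        intro y y' hy hy'
        have := hmono _ hy _ hy'
        simp only at this
        rw [hd, inner_smul_left, EuclideanSpace.inner_single_left] at this
        simpa using this
      obtain ⟨⟨⟨_, y⟩, ⟨hy, hya⟩, rfl⟩, ⟨⟨_, z⟩, ⟨hz, hzb⟩, rfl⟩⟩ := hx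
      obtain ⟨⟨⟨_, y'⟩, ⟨hy', hya'⟩, rfl⟩, ⟨⟨_, z'⟩, ⟨hz', hzb'⟩, hzz'⟩⟩ := hx'
      simp only at hzz'
      subst hzz'
      simp only [Set.mem_ofPred_eq] at hya hzb hya' hzb'
      rcases lt_or_gt_of_ne ht0 with h | h
      · have := hinner z y' hz hy'
        nlinarith
      · have := hinner y z' hy hz'
        nlinarith
    · refine (meas_image _ ?_).inter (meas_image _ ?_)
      · exact hΓ.inter (isClosed_le (by fun_prop) continuous_const)
      · exact hΓ.inter (isClosed_le continuous_const (by fun_prop))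
  refine measure_mono_null (t := ⋃ i, ⋃ a, ⋃ b, ⋃ _ : a < b, S i a b) ?_ ?_
  · rintro x ⟨y, z, hy, hz, hyz⟩
    obtain ⟨i, hi⟩ : ∃ i, y i ≠ z i := by
      by_contra! h
      exact hyz (by ext i; exact h i)
    simp only [Set.mem_iUnion]
    have aux : ∀ y z : E n, (x, y) ∈ Γ → (x, z) ∈ Γ → y i < z i →
        ∃ i a b, ∃ _ : a < b, x ∈ S i a b := by
      intro y z hy hz h
      obtain ⟨a, ha, ha'⟩ := exists_rat_btwn h
      obtain ⟨b, hb, hb'⟩ := exists_rat_btwn ha'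
      exact ⟨i, a, b, by exact_mod_cast hb, ⟨(x, y), ⟨hy, ha.le⟩, rfl⟩, ⟨(x, z), ⟨hz, hb'.le⟩, rfl⟩⟩
    rcases lt_or_gt_of_ne hi with h | h
    · exact aux y z hy hz h
    · exact aux z y hz hy h
  · simp only [measure_iUnion_null_iff]
    exact hS

/-! ### Existence of optimal plans -/

/-- The quadratic transport cost of a plan. -/
noncomputable def cost {n : ℕ} (π : Measure (E n × E n)) : ℝ≥0∞ := ∫⁻ p, ‖p.1 - p.2‖ₑ ^ 2 ∂π

/-- `π` is a coupling of `μ` and `ν`. -/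
def IsCoupling {n : ℕ} (μ ν : Measure (E n)) (π : Measure (E n × E n)) : Prop :=
  π.map Prod.fst = μ ∧ π.map Prod.snd = ν

theorem IsCoupling.isProbabilityMeasure {n : ℕ} {μ ν : Measure (E n)} [IsProbabilityMeasure μ]
    {π : Measure (E n × E n)} (h : IsCoupling μ ν π) : IsProbabilityMeasure π := by
  constructor
  have := congrArg (fun m : Measure (E n) => m Set.univ) h.1
  simpa [Measure.map_apply measurable_fst MeasurableSet.univ] using this

/-- The Kantorovich problem has a solution. -/
theorem exists_optimal_coupling {n : ℕ} (μ ν : Measure (E n)) [hμ : IsProbabilityMeasure μ]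
    [hν : IsProbabilityMeasure ν] :
    ∃ π, IsCoupling μ ν π ∧ ∀ π', IsCoupling μ ν π' → cost π ≤ cost π' := by
  let K : Set (ProbabilityMeasure (E n × E n)) := {π | IsCoupling μ ν (π : Measure (E n × E n))}
  have hclosed : IsClosed K := by
    have h1 := ProbabilityMeasure.continuous_map (Ω := E n × E n) (Ω' := E n) continuous_fst
    have h2 := ProbabilityMeasure.continuous_map (Ω := E n × E n) (Ω' := E n) continuous_snd
    let μ₀ : ProbabilityMeasure (E n) := ⟨μ, hμ⟩
    let ν₀ : ProbabilityMeasure (E n) := ⟨ν, hν⟩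
    have : K = {π | π.map (measurable_fst.aemeasurable) = μ₀} ∩
        {π | π.map (measurable_snd.aemeasurable) = ν₀} := by
      ext π
      change _ ↔ π.map _ = μ₀ ∧ π.map _ = ν₀
      exact ⟨fun h => ⟨Subtype.ext h.1, Subtype.ext h.2⟩,
        fun h => ⟨congrArg Subtype.val h.1, congrArg Subtype.val h.2⟩⟩
    rw [this]
    exact (isClosed_eq h1 continuous_const).inter (isClosed_eq h2 continuous_const)
  -- Both marginals are fixed, and a single measure on `ℝⁿ` is tight.
  have htight : IsTightMeasureSet
      {((π : ProbabilityMeasure (E n × E n)) : Measure (E n × E n)) | π ∈ K} := by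
    refine IsTightMeasureSet.prodMk ?_ ?_
    · refine (isTightMeasureSet_singleton (μ := μ)).subset ?_
      rintro _ ⟨_, ⟨π, hπ, rfl⟩, rfl⟩
      exact hπ.1
    · refine (isTightMeasureSet_singleton (μ := ν)).subset ?_
      rintro _ ⟨_, ⟨π, hπ, rfl⟩, rfl⟩
      exact hπ.2
  have hcompact : IsCompact K := by
    have := isCompact_closure_of_isTightMeasureSet htight
    rwa [hclosed.closure_eq] at this
  have hne : K.Nonempty :=
    ⟨⟨μ.prod ν, inferInstance⟩, 
      show IsCoupling μ ν (μ.prod ν) from ⟨by simp, by simp⟩⟩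
  have hlsc : LowerSemicontinuous
      fun π : ProbabilityMeasure (E n × E n) => cost (π : Measure (E n × E n)) := by
    have := lowerSemicontinuous_lintegral_continuous
      (f := fun p : E n × E n => ‖p.1 - p.2‖₊ ^ 2) (by fun_prop)
    simpa [cost, enorm_eq_nnnorm] using this
  obtain ⟨π, hπ, hmin⟩ := (hlsc.lowerSemicontinuousOn K).exists_isMinOn hne hcompact
  refine ⟨π, hπ, fun π' hπ' => ?_⟩
  exact hmin (a := (⟨π', hπ'.isProbabilityMeasure⟩ : ProbabilityMeasure (E n × E n))) hπ'

/-! ### Monotonicity of optimal plans -/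

/-- The squared norms cancel: the swap changes the cost by `2⟨x - x', y - y'⟩`. -/
theorem enorm_sub_sq_swap_lt {n : ℕ} {x y x' y' : E n} (h : inner ℝ (x - x') (y - y') < 0) :
    ‖x - y'‖ₑ ^ 2 + ‖x' - y‖ₑ ^ 2 < ‖x - y‖ₑ ^ 2 + ‖x' - y'‖ₑ ^ 2 := by
  have key : ‖x - y'‖ ^ 2 + ‖x' - y‖ ^ 2 < ‖x - y‖ ^ 2 + ‖x' - y'‖ ^ 2 := by
    simp only [norm_sub_sq_real]
    simp only [inner_sub_left, inner_sub_right] at h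
    linarith
  simp only [← ofReal_norm]
  simp only [← ENNReal.ofReal_pow (norm_nonneg _)]
  rw [← ENNReal.ofReal_add (by positivity) (by positivity),
    ← ENNReal.ofReal_add (by positivity) (by positivity)]
  exact (ENNReal.ofReal_lt_ofReal_iff_of_nonneg (by positivity)).2 key

theorem isOpen_nonmonotone {n : ℕ} :
    IsOpen {q : (E n × E n) × (E n × E n) | inner ℝ (q.1.1 - q.2.1) (q.1.2 - q.2.2) < 0} :=
  isOpen_lt (by fun_prop) continuous_const

/-- Exchanging the targets of two independent copies wherever this lowers the cost shows that an
optimal plan is monotone almost surely. -/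
theorem prod_nonmonotone_eq_zero {n : ℕ} {μ ν : Measure (E n)} [IsProbabilityMeasure μ]
    {π : Measure (E n × E n)} (hπ : IsCoupling μ ν π)
    (hopt : ∀ π', IsCoupling μ ν π' → cost π ≤ cost π') (hfin : cost π ≠ ∞) :
    (π.prod π) {q | inner ℝ (q.1.1 - q.2.1) (q.1.2 - q.2.2) < 0} = 0 := by
  classical
  have := hπ.isProbabilityMeasure
  set m := π.prod π with hm
  set B : Set ((E n × E n) × (E n × E n)) :=
    {q | inner ℝ (q.1.1 - q.2.1) (q.1.2 - q.2.2) < 0} with hB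
  have hBm : MeasurableSet B := isOpen_nonmonotone.measurableSet
  have hswap : MeasurePreserving Prod.swap m m := Measure.measurePreserving_swap
  have hBswap : Prod.swap ⁻¹' B = B := by
    ext q
    simp only [hB, Set.mem_preimage, Set.mem_ofPred_eq, Prod.fst_swap, Prod.snd_swap]
    rw [← neg_sub q.1.1, ← neg_sub q.1.2, inner_neg_neg]
  have hBint : ∀ f : (E n × E n) × (E n × E n) → ℝ≥0∞, Measurable f →
      ∫⁻ q in B, f q.swap ∂m = ∫⁻ q in B, f q ∂m := by
    intro f hf
    have := hswap.setLIntegral_comp_preimage hBm hf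
    rwa [hBswap] at this
  let Y : (E n × E n) × (E n × E n) → E n := fun q => if q ∈ B then q.2.2 else q.1.2
  have hY : Measurable Y := Measurable.ite hBm (by fun_prop) (by fun_prop)
  have hfst : m.map Prod.fst = π := by simp [hm]
  -- Both `B` and `m` are invariant under exchanging the copies, so on `B` the targets `q.2.2` and
  -- `q.1.2` have the same law.
  have hYlaw : m.map Y = ν := by
    refine (Eq.trans ?_ (show m.map (fun q => q.1.2) = π.map Prod.snd by
      rw [← hfst, Measure.map_map measurable_snd measurable_fst]; rfl)).trans hπ.2
    refine Measure.ext_of_lintegral _ fun f hf => ?_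
    rw [lintegral_map hf hY, lintegral_map hf (by fun_prop), ← lintegral_add_compl _ hBm,
      ← lintegral_add_compl (fun q : (E n × E n) × (E n × E n) => f q.1.2) hBm]
    congr 1
    · rw [← hBint (fun q => f q.1.2) (by fun_prop)]
      exact setLIntegral_congr_fun hBm fun q hq => by simp [Y, hq]
    · exact setLIntegral_congr_fun hBm.compl fun q hq => by
        have : q ∉ B := hq
        simp [Y, this]
  have hcoup : IsCoupling μ ν (m.map fun q => (q.1.1, Y q)) := by
    constructor
    · rw [Measure.map_map measurable_fst (by fun_prop), ← hπ.1, ← hfst,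
        Measure.map_map measurable_fst measurable_fst]
      rfl
    · rw [Measure.map_map measurable_snd (by fun_prop), ← hYlaw]
      rfl
  have hle := hopt _ hcoup
  have hcost : cost π = ∫⁻ q, ‖q.1.1 - q.1.2‖ₑ ^ 2 ∂m := by
    rw [cost, ← hfst, lintegral_map (by fun_prop) measurable_fst]
  have hcost' : cost (m.map fun q => (q.1.1, Y q)) = ∫⁻ q, ‖q.1.1 - Y q‖ₑ ^ 2 ∂m := by
    rw [cost, lintegral_map (by fun_prop) (by fun_prop)]
  rw [hcost', hcost, ← lintegral_add_compl _ hBm,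
    ← lintegral_add_compl (fun q => ‖q.1.1 - Y q‖ₑ ^ 2) hBm] at hle
  rw [hcost, ← lintegral_add_compl _ hBm] at hfin
  rw [setLIntegral_congr_fun (f := fun q => ‖q.1.1 - Y q‖ₑ ^ 2)
      (g := fun q => ‖q.1.1 - q.2.2‖ₑ ^ 2) hBm
      (fun q hq => by simp [Y, hq]),
    setLIntegral_congr_fun (f := fun q => ‖q.1.1 - Y q‖ₑ ^ 2)
      (g := fun q => ‖q.1.1 - q.1.2‖ₑ ^ 2) hBm.compl
      (fun q hq => by have : q ∉ B := hq; simp [Y, this])] at hle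
  -- The common cost off `B` is finite and cancels.
  have hle' := (ENNReal.add_le_add_iff_right (ENNReal.add_ne_top.1 hfin).2).1 hle
  by_contra hpos
  have hsum_fin : ∫⁻ q in B, (‖q.1.1 - q.1.2‖ₑ ^ 2 + ‖q.2.1 - q.2.2‖ₑ ^ 2) ∂m ≠ ∞ := by
    rw [lintegral_add_left (by fun_prop)]
    refine ENNReal.add_ne_top.2 ⟨(ENNReal.add_ne_top.1 hfin).1, ?_⟩
    have := hBint (fun q => ‖q.1.1 - q.1.2‖ₑ ^ 2) (by fun_prop)
    simp only [Prod.fst_swap] at this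
    rw [this]
    exact (ENNReal.add_ne_top.1 hfin).1
  have hpt : ∀ q ∈ B, ‖q.1.1 - q.2.2‖ₑ ^ 2 + ‖q.2.1 - q.1.2‖ₑ ^ 2 <
      ‖q.1.1 - q.1.2‖ₑ ^ 2 + ‖q.2.1 - q.2.2‖ₑ ^ 2 := fun q hq => enorm_sub_sq_swap_lt hq
  have hlt : ∫⁻ q in B, (‖q.1.1 - q.2.2‖ₑ ^ 2 + ‖q.2.1 - q.1.2‖ₑ ^ 2) ∂m <
      ∫⁻ q in B, (‖q.1.1 - q.1.2‖ₑ ^ 2 + ‖q.2.1 - q.2.2‖ₑ ^ 2) ∂m := by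
    refine setLIntegral_strict_mono hBm hpos (by fun_prop) ?_ ?_
    · exact ((setLIntegral_mono (by fun_prop) fun q hq => (hpt q hq).le).trans_lt
        (lt_top_iff_ne_top.2 hsum_fin)).ne
    · exact ae_of_all _ hpt
  -- By symmetry each two-copy integral is twice a one-copy integral, so `hlt` contradicts twice
  -- `hle'`.
  rw [lintegral_add_left (by fun_prop), lintegral_add_left (by fun_prop)] at hlt
  have e1 := hBint (fun q => ‖q.1.1 - q.1.2‖ₑ ^ 2) (by fun_prop)
  have e2 := hBint (fun q => ‖q.1.1 - q.2.2‖ₑ ^ 2) (by fun_prop)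
  simp only [Prod.fst_swap, Prod.snd_swap] at e1 e2
  rw [e1, e2] at hlt
  exact absurd hlt (not_lt.2 (add_le_add hle' hle'))

/-- The support of an optimal plan is monotone. -/
theorem monotone_support_of_optimal {n : ℕ} {μ ν : Measure (E n)} [IsProbabilityMeasure μ]
    {π : Measure (E n × E n)} (hπ : IsCoupling μ ν π)
    (hopt : ∀ π', IsCoupling μ ν π' → cost π ≤ cost π') (hfin : cost π ≠ ∞) :
    ∀ p ∈ π.support, ∀ q ∈ π.support, 0 ≤ inner ℝ (p.1 - q.1) (p.2 - q.2) := by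
  have := hπ.isProbabilityMeasure
  intro p hp q hq
  by_contra! hneg
  have hnhds := isOpen_nonmonotone.mem_nhds (show (p, q) ∈ {q : (E n × E n) × (E n × E n) |
    inner ℝ (q.1.1 - q.2.1) (q.1.2 - q.2.2) < 0} from hneg)
  obtain ⟨U, hU, V, hV, hUV⟩ := mem_nhds_prod_iff.1 hnhds
  have h0 := measure_mono_null hUV (prod_nonmonotone_eq_zero hπ hopt hfin)
  rw [Measure.prod_prod, mul_eq_zero] at h0
  rcases h0 with h0 | h0
  · exact ((Measure.mem_support_iff_forall p).1 hp U hU).ne' h0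
  · exact ((Measure.mem_support_iff_forall q).1 hq V hV).ne' h0

/-! ### From plans to maps: Brenier's theorem -/

/-- A plan whose fibres over almost every point are single points is induced by a map. -/
theorem exists_map_of_singleValued {n : ℕ} {π : Measure (E n × E n)} [IsProbabilityMeasure π]
    {Γ : Set (E n × E n)} (hΓ : ∀ᵐ p ∂π, p ∈ Γ)
    (hsingle : ∀ᵐ x ∂π.fst, ∀ y z, (x, y) ∈ Γ → (x, z) ∈ Γ → y = z) :
    ∃ T : E n → E n, Measurable T ∧ π = π.fst.map fun x => (x, T x) := by
  let κ := π.condKernel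
  have hκ : π.fst ⊗ₘ κ = π := π.disintegrate π.condKernel
  have hfib : ∀ᵐ x ∂π.fst, ∀ᵐ y ∂κ x, (x, y) ∈ Γ := by
    refine Measure.ae_ae_of_ae_compProd (p := fun p => p ∈ Γ) ?_
    rwa [hκ]
  -- Almost every conditional law is a Dirac mass; its barycentre is the atom and depends measurably
  -- on `x`.
  let T : E n → E n := fun x => ∫ y, y ∂κ x
  have hT : Measurable T := (stronglyMeasurable_id.integral_kernel).measurable
  have hgraph : ∀ᵐ p ∂π, p.2 = T p.1 := by
    rw [← hκ, Measure.ae_compProd_iff (measurableSet_eq_fun measurable_snd (by fun_prop))]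
    filter_upwards [hfib, hsingle] with x hx hs
    obtain ⟨y₀, hy₀⟩ := hx.exists
    have hconst : ∀ᵐ y ∂κ x, y = y₀ := by
      filter_upwards [hx] with y hy using hs y y₀ hy hy₀
    have hTx : T x = y₀ := by
      simp only [T]
      rw [integral_congr_ae hconst]
      simp
    filter_upwards [hconst] with y hy
    simp [hTx, hy]
  refine ⟨T, hT, ?_⟩
  rw [Measure.fst, Measure.map_map (by fun_prop) measurable_fst]
  conv_lhs => rw [← Measure.map_id (μ := π)]
  refine Measure.map_congr ?_
  filter_upwards [hgraph] with p hp
  exact Prod.ext rfl hp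

theorem isCoupling_map {n : ℕ} {α : Type*} [MeasurableSpace α] {σ : Measure α}
    {S T : α → E n} (hS : AEMeasurable S σ) (hT : AEMeasurable T σ) :
    IsCoupling (σ.map S) (σ.map T) (σ.map fun x => (S x, T x)) := by
  constructor
  · rw [AEMeasurable.map_map_of_aemeasurable (by fun_prop) (by fun_prop)]
    rfl
  · rw [AEMeasurable.map_map_of_aemeasurable (by fun_prop) (by fun_prop)]
    rfl

theorem cost_map {n : ℕ} {α : Type*} [MeasurableSpace α] {σ : Measure α}
    {S T : α → E n} (hS : AEMeasurable S σ) (hT : AEMeasurable T σ) :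
    cost (σ.map fun x => (S x, T x)) = ∫⁻ x, ‖S x - T x‖ₑ ^ 2 ∂σ := by
  rw [cost, lintegral_map' (by fun_prop) (by fun_prop)]

theorem cost_prod_ne_top {n : ℕ} (μ ν : P2 n) : cost (μ.toMeasure.prod ν.toMeasure) ≠ ∞ := by
  have := μ.isProbabilityMeasure
  have := ν.isProbabilityMeasure
  have hμ : MemLp (id : E n → E n) 2 μ.toMeasure := by
    refine ⟨aestronglyMeasurable_id, ?_⟩
    rw [eLpNorm_lt_top_iff_lintegral_rpow_enorm_lt_top (by simp) (by simp)]
    simpa using μ.secondMoment_lt_top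
  have hν : MemLp (id : E n → E n) 2 ν.toMeasure := by
    refine ⟨aestronglyMeasurable_id, ?_⟩
    rw [eLpNorm_lt_top_iff_lintegral_rpow_enorm_lt_top (by simp) (by simp)]
    simpa using ν.secondMoment_lt_top
  have h := (hμ.comp_fst ν.toMeasure).sub (hν.comp_snd μ.toMeasure)
  have h2 := h.2
  rw [eLpNorm_lt_top_iff_lintegral_rpow_enorm_lt_top (by simp) (by simp)] at h2
  refine ne_of_lt ?_
  simpa [cost] using h2

/-- Existence in Brenier's theorem. -/
theorem exists_isOptimalTransportMap {n : ℕ} (σ ρ : P2 n)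
    (hσ : σ.toMeasure ≪ (volume : Measure (E n))) :
    ∃ T : Lp (E n) 2 σ.toMeasure, IsOptimalTransportMap σ.toMeasure ρ.toMeasure T := by
  have := σ.isProbabilityMeasure
  have := ρ.isProbabilityMeasure
  obtain ⟨π, hπ, hopt⟩ := exists_optimal_coupling σ.toMeasure ρ.toMeasure
  have hprob := hπ.isProbabilityMeasure
  have hfst : π.fst = σ.toMeasure := hπ.1
  have hfin : cost π ≠ ∞ :=
    ne_top_of_le_ne_top (cost_prod_ne_top σ ρ) (hopt _ ⟨by simp, by simp⟩)
  have hsingle : ∀ᵐ x ∂π.fst, ∀ y z, (x, y) ∈ π.support → (x, z) ∈ π.support → y = z := by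
    rw [hfst]
    refine hσ.ae_le (measure_mono_null ?_ (volume_multivalued_of_monotone Measure.isClosed_support
      (monotone_support_of_optimal hπ hopt hfin)))
    intro x hx
    simpa using hx
  obtain ⟨T, hT, hgraph⟩ := exists_map_of_singleValued Measure.support_mem_ae hsingle
  rw [hfst] at hgraph
  have hpush : σ.toMeasure.map T = ρ.toMeasure := by
    rw [← hπ.2, hgraph, Measure.map_map measurable_snd (by fun_prop)]
    rfl
  have hmem : MemLp T 2 σ.toMeasure := by
    refine ⟨hT.aestronglyMeasurable, ?_⟩
    rw [eLpNorm_lt_top_iff_lintegral_rpow_enorm_lt_top (by simp) (by simp)]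
    have := ρ.secondMoment_lt_top
    rw [← hpush, lintegral_map (by fun_prop) hT] at this
    simpa using this
  have hcost : cost π = ∫⁻ x, ‖T x - x‖ₑ ^ 2 ∂σ.toMeasure := by
    rw [hgraph, cost_map (S := fun x => x) aemeasurable_id' hT.aemeasurable]
    simp only [enorm_sub_rev]
  refine ⟨hmem.toLp T, (Lp.aestronglyMeasurable _).aemeasurable, ?_, fun S hS hSρ => ?_⟩
  · rw [← hpush]
    exact Measure.map_congr hmem.coeFn_toLp
  · have hle := hopt _ (by
      have := isCoupling_map (S := fun x => x) aemeasurable_id' hS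
      rwa [hSρ, Measure.map_id'] at this)
    rw [cost_map (S := fun x => x) aemeasurable_id' hS, hcost] at hle
    rw [lintegral_congr_ae (g := fun x => ‖T x - x‖ₑ ^ 2)
      (hmem.coeFn_toLp.mono fun x hx => by simp only [hx])]
    simpa only [enorm_sub_rev] using hle

theorem lot_isOptimalTransportMap {n : ℕ} (σ ρ : P2 n)
    (hσ : σ.toMeasure ≪ (volume : Measure (E n))) :
    IsOptimalTransportMap σ.toMeasure ρ.toMeasure (lot σ.toMeasure ρ.toMeasure) := by
  have h := exists_isOptimalTransportMap σ ρ hσ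
  rw [lot, dif_pos h]
  exact h.choose_spec

/-! ### The embedding and the Wasserstein distance -/

/-- The push-forward of `μ ∈ 𝒫₂` under a map in `L²(μ)` lies in `𝒫₂`. -/
noncomputable def P2.map {n : ℕ} (μ : P2 n) (h : E n → E n) (hh : MemLp h 2 μ.toMeasure) : P2 n where
  toMeasure := μ.toMeasure.map h
  isProbabilityMeasure :=
    have := μ.isProbabilityMeasure
    Measure.isProbabilityMeasure_map hh.1.aemeasurable
  secondMoment_lt_top := by
    rw [lintegral_map' (by fun_prop) hh.1.aemeasurable]
    have := hh.2
    rw [eLpNorm_lt_top_iff_lintegral_rpow_enorm_lt_top (by simp) (by simp)] at this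
    simpa using this

theorem W2_map_le_eLpNorm {n : ℕ} {α : Type*} [MeasurableSpace α] {σ : Measure α}
    {S T : α → E n} (hS : AEMeasurable S σ) (hT : AEMeasurable T σ) :
    W2 (σ.map S) (σ.map T) ≤ eLpNorm (fun x => S x - T x) 2 σ := by
  have h : W2 (σ.map S) (σ.map T) ≤ cost (σ.map fun x => (S x, T x)) ^ (1 / 2 : ℝ) :=
    ENNReal.rpow_le_rpow (iInf₂_le _ (isCoupling_map hS hT)) (by norm_num)
  rw [eLpNorm_eq_lintegral_rpow_enorm_toReal (by simp) (by simp)]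
  simpa [cost_map hS hT] using h

/-- The maps `h ∘ T`, `h ∈ H`, as a subset of `L²(σ)`. -/
def compSet {n : ℕ} (σ : Measure (E n)) (H : Set (E n → E n)) (T : E n → E n) :
    Set (Lp (E n) 2 σ) :=
  {g | ∃ h ∈ H, g =ᵐ[σ] fun x => h (T x)}

/-- Composition `h ↦ h ∘ T` is linear in the outer map `h`. -/
theorem convex_compSet {n : ℕ} (σ : Measure (E n)) {H : Set (E n → E n)} (hH : Convex ℝ H)
    (T : E n → E n) : Convex ℝ (compSet σ H T) := by
  rintro f ⟨h, hh, hf⟩ g ⟨k, hk, hg⟩ a b ha hb hab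
  refine ⟨a • h + b • k, hH hh hk ha hb hab, ?_⟩
  filter_upwards [Lp.coeFn_add (a • f) (b • g), Lp.coeFn_smul a f, Lp.coeFn_smul b g, hf, hg]
    with x h1 h2 h3 h4 h5
  rw [h1, Pi.add_apply, h2, h3, Pi.smul_apply, Pi.smul_apply, h4, h5]
  rfl

theorem IsEpsCompatible.dist_lt {n : ℕ} {σ μ : P2 n} {H : Set (E n → E n)} {ε : ℝ}
    (hμ : IsEpsCompatible σ μ H ε)
    {h : E n → E n} (hh : h ∈ H) {g : Lp (E n) 2 σ.toMeasure}
    (hg : g =ᵐ[σ.toMeasure] fun x => h (lot σ.toMeasure μ.toMeasure x)) :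
    dist (lot σ.toMeasure (μ.toMeasure.map h)) g < ε := by
  rw [Lp.dist_def]
  refine ENNReal.toReal_lt_of_lt_ofReal ?_
  refine (eLpNorm_congr_ae ?_).trans_lt (hμ h hh)
  filter_upwards [hg] with x hx
  rw [Pi.sub_apply, hx]

/-- Since `F_σ(μ)` pushes `σ` to `μ`, composing with it carries `L²(μ)` into `L²(σ)`. -/
theorem exists_ae_eq_comp_lot {n : ℕ} {σ μ : P2 n}
    (hσ : σ.toMeasure ≪ (volume : Measure (E n))) {h : E n → E n}
    (hmem : MemLp h 2 μ.toMeasure) :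
    ∃ g : Lp (E n) 2 σ.toMeasure,
      g =ᵐ[σ.toMeasure] fun x => h (lot σ.toMeasure μ.toMeasure x) := by
  have hT := lot_isOptimalTransportMap σ μ hσ
  rw [← hT.2.1] at hmem
  have := (memLp_map_measure_iff hmem.1 hT.1).1 hmem
  exact ⟨this.toLp _, this.coeFn_toLp⟩

/-- `F_σ(ℋ ⋆ μ)` lies in the open `ε`-thickening of the convex set `ℋ ∘ F_σ(μ)`. -/
theorem lotImage_orbit_subset_thickening {n : ℕ} {σ μ : P2 n}
    (hσ : σ.toMeasure ≪ (volume : Measure (E n))) {H : Set (E n → E n)}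
    (hHμ : ∀ h ∈ H, MemLp h 2 μ.toMeasure) {ε : ℝ} (hμ : IsEpsCompatible σ μ H ε) :
    lotImage σ (orbit H μ) ⊆
      Metric.thickening ε (compSet σ.toMeasure H (lot σ.toMeasure μ.toMeasure)) := by
  rintro _ ⟨ρ, ⟨h, hh, hρ⟩, rfl⟩
  obtain ⟨g, hg⟩ := exists_ae_eq_comp_lot hσ (hHμ h hh)
  simp only [hρ]
  exact Metric.mem_thickening_iff.2 ⟨g, ⟨h, hh, hg⟩, hμ.dist_lt hh hg⟩

/-- Only the push-forward property of the two maps matters here, not their optimality. -/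
theorem W2_le_edist_lot {n : ℕ} {σ : P2 n} (hσ : σ.toMeasure ≪ (volume : Measure (E n)))
    (μ ν : P2 n) : W2 μ.toMeasure ν.toMeasure ≤
      edist (lot σ.toMeasure μ.toMeasure) (lot σ.toMeasure ν.toMeasure) := by
  have h1 := lot_isOptimalTransportMap σ μ hσ
  have h2 := lot_isOptimalTransportMap σ ν hσ
  have := W2_map_le_eLpNorm h1.1 h2.1
  rw [h1.2.1, h2.2.1] at this
  rw [Lp.edist_def]
  exact this

/-! ### Separation in Hilbert space -/

/-- Openness of both convex sets makes Hahn–Banach strict on both sides; Riesz represents the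
functional by a vector. -/
theorem linearlySeparable_of_convex_thickening {V : Type*} [NormedAddCommGroup V]
    [InnerProductSpace ℝ V] [CompleteSpace V] {A B C D : Set V} {ε : ℝ}
    (hC : Convex ℝ C) (hD : Convex ℝ D) (hA : A ⊆ Metric.thickening ε C)
    (hB : B ⊆ Metric.thickening ε D)
    (hdisj : Disjoint (Metric.thickening ε C) (Metric.thickening ε D)) :
    LinearlySeparable A B := by
  obtain ⟨f, u, hf, hg⟩ := geometric_hahn_banach_open_open (hC.thickening ε)
    Metric.isOpen_thickening (hD.thickening ε) Metric.isOpen_thickening hdisj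
  refine ⟨(InnerProductSpace.toDual ℝ V).symm f, u, fun a ha => ?_, fun b hb => ?_⟩
  · rw [InnerProductSpace.toDual_symm_apply]
    exact hf a (hA ha)
  · rw [InnerProductSpace.toDual_symm_apply]
    exact hg b (hB hb)

end LOT

theorem mainTheorem5 {n : ℕ} (σ μ ν : LOT.P2 n)
    (hσ : σ.toMeasure ≪ (volume : Measure (LOT.E n)))
    (H : Set (LOT.E n → LOT.E n))
    (hHσ : ∀ h ∈ H, MemLp h 2 σ.toMeasure)
    (hHμ : ∀ h ∈ H, MemLp h 2 μ.toMeasure)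
    (hHν : ∀ h ∈ H, MemLp h 2 ν.toMeasure)
    (hHconv : Convex ℝ H)
    (ε : ℝ) (hε : 0 < ε)
    (hμ : LOT.IsEpsCompatible σ μ H ε)
    (hν : LOT.IsEpsCompatible σ ν H ε)
    (hKμ : IsCompact (LOT.orbit H μ))
    (hKν : IsCompact (LOT.orbit H ν))
    (hW : ∀ h₁ ∈ H, ∀ h₂ ∈ H,
      ENNReal.ofReal (6 * ε) < LOT.W2 (μ.toMeasure.map h₁) (ν.toMeasure.map h₂)) :
    LOT.LinearlySeparable (LOT.lotImage σ (LOT.orbit H μ)) (LOT.lotImage σ (LOT.orbit H ν)) := by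
  refine LOT.linearlySeparable_of_convex_thickening (LOT.convex_compSet _ hHconv _)
    (LOT.convex_compSet _ hHconv _) (LOT.lotImage_orbit_subset_thickening hσ hHμ hμ)
    (LOT.lotImage_orbit_subset_thickening hσ hHν hν) (Set.disjoint_left.2 fun f hfμ hfν => ?_)
  obtain ⟨g₁, ⟨h₁, hh₁, hg₁⟩, hd₁⟩ := Metric.mem_thickening_iff.1 hfμ
  obtain ⟨g₂, ⟨h₂, hh₂, hg₂⟩, hd₂⟩ := Metric.mem_thickening_iff.1 hfν
  have hF₁ := hμ.dist_lt hh₁ hg₁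
  have hF₂ := hν.dist_lt hh₂ hg₂
  have hlt := (hW h₁ hh₁ h₂ hh₂).trans_le
    (LOT.W2_le_edist_lot hσ (μ.map h₁ (hHμ h₁ hh₁)) (ν.map h₂ (hHν h₂ hh₂)))
  simp only [LOT.P2.map] at hlt
  rw [edist_dist, ENNReal.ofReal_lt_ofReal_iff_of_nonneg (by positivity)] at hlt
  -- The path through `g₁`, `f`, `g₂` has four legs shorter than `ε`, against a distance above `6ε`.
  have t₁ := dist_triangle4_right (LOT.lot σ.toMeasure (μ.toMeasure.map h₁))
    (LOT.lot σ.toMeasure (ν.toMeasure.map h₂)) g₁ g₂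
  have t₂ := dist_triangle_left g₁ g₂ f
  linarith
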